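/- Let $\kappa$ be a field and let $Sch_\kappa$ be the category of separated schemes of finite type over $\kappa$. A fat point is an $\mathfrak m\in Sch_\kappa$ whose reduction is $\operatorname{Spec}\kappa$. A sieve is a subfunctor $\mathcal X$ of the restriction to fat points of the functor of points $X^\circ$ of some $X\in Sch_\kappa$ (its ambient scheme). It is subschemic if it is the image of $\varphi^\circ: Y^\circ\to X^\circ$ for a morphism $\varphi:Y\to X$ in $Sch_\kappa$, and formal if for every fat point $\mathfrak m$ there is a subschemic sieve $\mathcal Y_{\mathfrak m}\subset\mathcal X$ with $\mathcal Y_{\mathfrak m}(\mathfrak m)=\mathcal X(\mathfrak m)$. A morphism of sieves $\mathcal Y\to\mathcal X$ (with ambient schemes $Y$, $X$) is a natural transformation $\nu$ such that for each $\varphi:Z\to Y$ in $Sch_\kappa$ with image of $\varphi^\circ$ in $\mathcal Y$, the composite $Z^\circ\to\mathcal Y\to\mathcal X\subset X^\circ$ is $\psi^\circ$ for some morphism $\psi:Z\to X$. Let $\mathbf{Gr}(\mathrm{Form}_\kappa)$ be the Grothendieck ring of formal sieves: generated by their isomorphism classes, with the relations $[\mathcal X]+[\mathcal Y]=[\mathcal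 X\cup\mathcal Y]+[\mathcal X\cap\mathcal Y]$ (same ambient scheme), $[\emptyset]=0$, $[\mathcal X\times\mathcal Y]=[\mathcal X][\mathcal Y]$ and $[\operatorname{Spec}\kappa]=1$. Put $\mathbb L=[\mathbb A^1_\kappa]$ and let $\mathcal H_\kappa=\mathbf{Gr}(\mathrm{Form}_\kappa)_{\mathbb L}$ be the localization at $\mathbb L$. Let $\mathfrak x$ be an admissible arc, given by a complete noetherian local $\kappa$-algebra $R$ with maximal ideal $\mathcal M$ and residue field $\kappa$ such that $\{\mathcal M^n\}_n$ is infinite. For $n\ge1$ write $\mathfrak n=\operatorname{Spec}R/\mathcal M^n$ (and $\mathfrak m=\operatorname{Spec}R/\mathcal M^m$, etc.) and $\ell(\mathfrak n)=\dim_\kappa R/\mathcal M^n$. Let $X\in Sch_\kappa$, $d=\dim X$. Let $\nabla_{\mathfrak n}X$ be the functor $T\mapsto X(T\times_\kappa\mathfrak n)$, let $\nabla_{\mathfrak x}X=\varprojlim_n\nabla_{\mathfrak n}X$, and let $\nabla_{\mathfrak x/\mathfrak n}X$ be the image, as a functor on fat points, of $\nabla_{\mathfrak x}X\to\nabla_{\mathfrak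 n}X$. The motivic Poincaré series of $X$ is $$P_{\mathfrak x}(X)(t)=\sum_{n\ge1}[\nabla_{\mathfrak x/\mathfrak n}X]\,\mathbb L^{-d\ell(\mathfrak n)}t^n\in\mathcal H_\kappa[[t]]$$ (a coefficient for which $\nabla_{\mathfrak x/\mathfrak n}X$ is not a formal sieve is read as $0$; under the hypotheses below this concerns at most finitely many $n$). A morphism of sieves $\mathcal Y\to\mathcal X$ is a piecewise trivial fibration with fiber $\mathbb A^r_\kappa$ if there is a finite partition of $\mathcal X$ into formal sieves $\mathcal S_i$ such that the inverse image of each $\mathcal S_i$ in $\mathcal Y$ is isomorphic over $\mathcal S_i$ to $\mathcal S_i\times\mathbb A^r_\kappa$. $X$ is $\mathfrak x$-laxly stable from $n_0\ge1$ on if $\nabla_{\mathfrak x/\mathfrak n}X$ is a formal sieve for all $n\ge n_0$ and if for all $m\ge n\ge n_0$ the sieve $\nabla_{\mathfrak x/\mathfrak m}X$ is the full inverse image of $\nabla_{\mathfrak x/\mathfrak n}X$ in $\nabla_{\mathfrak m}X$ and $\nabla_{\mathfrak x/\mathfrak m}X\to\nabla_{\mathfrak x/\mathfrak n}X$ is a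 piecewise trivial fibration with fiber $\mathbb A^r_\kappa$ for some $r=r(\mathfrak m,\mathfrak n)\ge 0$. $X$ is $\mathfrak x$-laxly stable if this holds for some $n_0$, and $\mathfrak x$-stable if moreover one can take $r(\mathfrak m,\mathfrak n)=d(\ell(\mathfrak m)-\ell(\mathfrak n))$ for all $m\ge n\ge n_0$. If $X$ is $\mathfrak x$-laxly stable from $n_0$ on, its lax defect function is $l(m)=r(\mathfrak m,\mathfrak n_0)-d(\ell(\mathfrak m)-\ell(\mathfrak n_0))$ for $m\ge n_0$. **Proposition.** If $X$ is $\mathfrak x$-laxly stable (from $n_0$ on) and the lax defect function is linear of slope $q$, i.e. $l(m)=qm+b$ for all $m\ge n_0$ with integers $q,b$, then $P_{\mathfrak x}(X)(t)$ belongs to $\mathcal H_\kappa\left[t,\frac1{1-\mathbb L^qt}\right]$, the $\mathcal H_\kappa$-subalgebra of $\mathcal H_\kappa[[t]]$ generated by $t$ and $\frac1{1-\mathbb L^qt}$. In particular, if $X$ is $\mathfrak x$-stable, then $P_{\mathfrak x}(X)(t)$ belongs to $\mathcal H_\kappa\left[t,\frac1{1-t}\right]$. -/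

import Mathlib

universe u

open CategoryTheory AlgebraicGeometry Opposite

namespace SchemicMotivic

noncomputable section

/-! ### Schemes over a field, fat points, sieves -/

/-- Schemes over the field `κ`. -/
abbrev KSch (κ : Type u) [Field κ] : Type (u + 1) := Over (Spec (CommRingCat.of κ))

/-- Separated schemes of finite type over `κ`. -/
def IsSch {κ : Type u} [Field κ] (X : KSch κ) : Prop :=
  IsSeparated X.hom ∧ LocallyOfFiniteType X.hom ∧ QuasiCompact X.hom

/-- A fat point over `κ` is a separated scheme `𝔪` of finite type over `κ` whose reduction is
`Spec κ`, i.e. which contains `Spec κ` (the unit `𝟙_` of the cartesian category of `κ`-schemes)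
as a closed subscheme with the same underlying space. -/
def isFatPoint (κ : Type u) [Field κ] : ObjectProperty (KSch κ) := fun 𝔪 =>
  IsSch 𝔪 ∧ ∃ i : MonoidalCategoryStruct.tensorUnit (KSch κ) ⟶ 𝔪,
    IsClosedImmersion i.left ∧ Surjective i.left

/-- The category of fat points over `κ`. -/
abbrev Fat (κ : Type u) [Field κ] : Type (u + 1) := (isFatPoint κ).FullSubcategory

/-- Restriction of a presheaf on `κ`-schemes to fat points. -/
abbrev onFat {κ : Type u} [Field κ] (P : (KSch κ)ᵒᵖ ⥤ Type u) : (Fat κ)ᵒᵖ ⥤ Type u :=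
  (isFatPoint κ).ι.op ⋙ P

/-- Restriction of a morphism of presheaves to fat points. -/
abbrev onFatMap {κ : Type u} [Field κ] {P Q : (KSch κ)ᵒᵖ ⥤ Type u} (φ : P ⟶ Q) :
    onFat P ⟶ onFat Q :=
  Functor.whiskerLeft (isFatPoint κ).ι.op φ

/-- A subfunctor, on the category of fat points, of (the restriction of) an ambient presheaf.
It is a sieve when the ambient presheaf is the functor of points `X°` of a separated scheme `X`
of finite type over `κ`, see `KSieve.IsSieve`. -/
structure KSieve (κ : Type u) [Field κ] where
  /-- The ambient presheaf. -/
  amb : (KSch κ)ᵒᵖ ⥤ Type u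
  /-- The subfunctor. -/
  sub : Subfunctor (onFat amb)

namespace KSieve

variable {κ : Type u} [Field κ]

/-- The ambient presheaf is represented by a separated scheme of finite type over `κ`. -/
def IsSieve (𝒳 : KSieve κ) : Prop :=
  ∃ W : KSch κ, IsSch W ∧ Nonempty (𝒳.amb.RepresentableBy W)

/-- A formal sieve: for each fat point `𝔪` there is a subschemic sieve contained in `𝒳` (the image
of the map on functors of points given by some `Y ⟶ X`, for `Y` separated of finite type) which has
the same `𝔪`-points as `𝒳`. -/
def IsFormal (𝒳 : KSieve κ) : Prop :=
  𝒳.IsSieve ∧ ∀ 𝔪 : Fat κ, ∃ Y : KSch κ, IsSch Y ∧ ∃ φ : yoneda.obj Y ⟶ 𝒳.amb,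
    Subfunctor.range (onFatMap φ) ≤ 𝒳.sub ∧
      (Subfunctor.range (onFatMap φ)).obj (op 𝔪) = 𝒳.sub.obj (op 𝔪)

/-- A natural transformation `ν : 𝒴 ⟶ 𝒳` is a morphism of sieves if for each morphism of schemes
`φ : Z ⟶ Y` whose image lies in `𝒴`, the composite `ν ∘ φ°` is induced by a morphism of schemes
`ψ : Z ⟶ X` into the ambient scheme of `𝒳`. -/
def IsSieveHom {𝒴 𝒳 : KSieve κ} (ν : 𝒴.sub.toFunctor ⟶ 𝒳.sub.toFunctor) : Prop :=
  ∀ Z : KSch κ, IsSch Z → ∀ (φ : yoneda.obj Z ⟶ 𝒴.amb)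
    (h : Subfunctor.range (onFatMap φ) ≤ 𝒴.sub),
    ∃ ψ : yoneda.obj Z ⟶ 𝒳.amb,
      Subfunctor.lift (onFatMap φ) h ≫ ν ≫ 𝒳.sub.ι = onFatMap ψ

/-- An isomorphism in the category of sieves. -/
structure SieveIso (𝒴 𝒳 : KSieve κ) where
  /-- The underlying isomorphism of functors. -/
  iso : 𝒴.sub.toFunctor ≅ 𝒳.sub.toFunctor
  /-- It is a morphism of sieves. -/
  isSieveHom_hom : IsSieveHom iso.hom
  /-- Its inverse is a morphism of sieves. -/
  isSieveHom_inv : IsSieveHom iso.inv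

/-- The sieve `X°` of a scheme `X`. -/
def ofSch (X : KSch κ) : KSieve κ where
  amb := yoneda.obj X
  sub := ⊤

/-- The product of two sieves, in the product of the ambient spaces. -/
def prod (𝒳 𝒴 : KSieve κ) : KSieve κ where
  amb := FunctorToTypes.prod 𝒳.amb 𝒴.amb
  sub := 𝒳.sub.preimage (onFatMap FunctorToTypes.prod.fst) ⊓
    𝒴.sub.preimage (onFatMap FunctorToTypes.prod.snd)

end KSieve

/-- The affine space of dimension `r` over `κ`. -/
def affineSpace (κ : Type u) [Field κ] (r : ℕ) : KSch κ :=
  Over.mk (AffineSpace (ULift.{u} (Fin r)) (Spec (CommRingCat.of κ)) ↘ Spec (CommRingCat.of κ))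

/-! ### The Grothendieck ring of formal sieves -/

/-- Formal sieves. -/
abbrev FormalSieve (κ : Type u) [Field κ] : Type (u + 1) := {𝒳 : KSieve κ // 𝒳.IsFormal}

/-- The relations of the Grothendieck ring of formal sieves, on the free commutative ring on the
formal sieves: isomorphic sieves are identified, scissor relations hold in each ambient space, the
empty sieve is zero, the product is the product of sieves and the sieve of `Spec κ` is one. -/
inductive GrRel (κ : Type u) [Field κ] : MvPolynomial (FormalSieve κ) ℤ → Prop
  | iso (𝒴 𝒳 : FormalSieve κ) (e : KSieve.SieveIso 𝒴.1 𝒳.1) :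
      GrRel κ (MvPolynomial.X 𝒴 - MvPolynomial.X 𝒳)
  | scissor (P : (KSch κ)ᵒᵖ ⥤ Type u) (A B : Subfunctor (onFat P))
      (hA : KSieve.IsFormal ⟨P, A⟩) (hB : KSieve.IsFormal ⟨P, B⟩)
      (hu : KSieve.IsFormal ⟨P, A ⊔ B⟩) (hi : KSieve.IsFormal ⟨P, A ⊓ B⟩) :
      GrRel κ (MvPolynomial.X ⟨⟨P, A⟩, hA⟩ + MvPolynomial.X ⟨⟨P, B⟩, hB⟩
        - MvPolynomial.X ⟨⟨P, A ⊔ B⟩, hu⟩ - MvPolynomial.X ⟨⟨P, A ⊓ B⟩, hi⟩)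
  | empty (P : (KSch κ)ᵒᵖ ⥤ Type u) (h : KSieve.IsFormal ⟨P, ⊥⟩) :
      GrRel κ (MvPolynomial.X ⟨⟨P, ⊥⟩, h⟩)
  | mul (𝒳 𝒴 : FormalSieve κ) (h : (𝒳.1.prod 𝒴.1).IsFormal) :
      GrRel κ (MvPolynomial.X ⟨𝒳.1.prod 𝒴.1, h⟩ - MvPolynomial.X 𝒳 * MvPolynomial.X 𝒴)
  | one (h : (KSieve.ofSch (MonoidalCategoryStruct.tensorUnit (KSch κ))).IsFormal) :
      GrRel κ (MvPolynomial.X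
        ⟨KSieve.ofSch (MonoidalCategoryStruct.tensorUnit (KSch κ)), h⟩ - 1)

/-- The Grothendieck ring of the formal motivic site over `κ`. -/
abbrev GrForm (κ : Type u) [Field κ] : Type (u + 1) :=
  MvPolynomial (FormalSieve κ) ℤ ⧸ Ideal.span {p | GrRel κ p}

open Classical in
/-- The class of a formal sieve in the Grothendieck ring (and `0` if the argument is not a formal
sieve). -/
def sieveClass {κ : Type u} [Field κ] (𝒳 : KSieve κ) : GrForm κ :=
  if h : 𝒳.IsFormal then Ideal.Quotient.mk _ (MvPolynomial.X ⟨𝒳, h⟩) else 0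

/-- The Lefschetz class `𝕃`, the class of the affine line. -/
def lefschetz (κ : Type u) [Field κ] : GrForm κ :=
  sieveClass (KSieve.ofSch (affineSpace κ 1))

/-- The localization of the Grothendieck ring of formal sieves at `𝕃`. -/
abbrev HRing (κ : Type u) [Field κ] : Type (u + 1) := Localization.Away (lefschetz κ)

/-- `𝕃` as a unit of the localized ring. -/
def lefschetzUnit (κ : Type u) [Field κ] : (HRing κ)ˣ :=
  (IsLocalization.Away.algebraMap_isUnit (S := HRing κ) (lefschetz κ)).unit

/-! ### Admissible arcs -/

/-- An admissible arc over `κ`: a complete noetherian local `κ`-algebra `R` with residue field `κ`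
and maximal ideal `𝔐`, such that the set of the truncations `R / 𝔐 ^ n` is not finite. -/
structure Arc (κ : Type u) [Field κ] where
  /-- The underlying ring. -/
  R : Type u
  [commRing : CommRing R]
  [algebra : Algebra κ R]
  [isLocalRing : IsLocalRing R]
  [isNoetherianRing : IsNoetherianRing R]
  isAdicComplete : IsAdicComplete (IsLocalRing.maximalIdeal R) R
  residue_surjective : Function.Surjective (algebraMap κ (IsLocalRing.ResidueField R))
  infinite : (Set.range fun n : ℕ => IsLocalRing.maximalIdeal R ^ n).Infinite

attribute [instance] Arc.commRing Arc.algebra Arc.isLocalRing Arc.isNoetherianRing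

namespace Arc

variable {κ : Type u} [Field κ] (𝔵 : Arc κ)

/-- The truncation `R_n = R / 𝔐 ^ n`. -/
abbrev trunc (n : ℕ) : Type u := 𝔵.R ⧸ IsLocalRing.maximalIdeal 𝔵.R ^ n

/-- The `κ`-scheme `𝔫 = Spec (R / 𝔐 ^ n)`; for `n ≥ 1` these are the fat points of the point system
of the arc, for `n = 0` it is the empty scheme. -/
def pt (n : ℕ) : KSch κ := Over.mk (Spec.map (CommRingCat.ofHom (algebraMap κ (𝔵.trunc n))))

/-- The closed immersion of the `n`-th into the `m`-th truncation, for `n ≤ m`. -/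
def incl {n m : ℕ} (h : n ≤ m) : 𝔵.pt n ⟶ 𝔵.pt m :=
  Over.homMk (Spec.map (CommRingCat.ofHom
    (Ideal.Quotient.factor (Ideal.pow_le_pow_right h) : 𝔵.trunc m →+* 𝔵.trunc n))) (by
    dsimp only [pt, Over.mk_hom]
    rw [← Spec.map_comp, ← CommRingCat.ofHom_comp]
    rfl)

/-- The length `ℓ(𝔫)` of the `n`-th truncation, the dimension of `R / 𝔐 ^ n` over `κ`. -/
def len (n : ℕ) : ℕ := Module.finrank κ (𝔵.trunc n)

end Arc

/-! ### Generalized arc spaces -/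

section ArcSpaces

variable {κ : Type u} [Field κ]

/-- The generalized arc space `∇_N X`, as the functor `T ↦ X(T ×_κ N)`. -/
def nabla (X N : KSch κ) : (KSch κ)ᵒᵖ ⥤ Type u :=
  (MonoidalCategory.tensorRight N).op ⋙ yoneda.obj X

/-- The map `∇_N' X ⟶ ∇_N X` induced by `N ⟶ N'`. -/
def nablaMap (X : KSch κ) {N N' : KSch κ} (f : N ⟶ N') : nabla X N' ⟶ nabla X N :=
  Functor.whiskerRight (NatTrans.op ((MonoidalCategory.tensoringRight (KSch κ)).map f))
    (yoneda.obj X)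

variable (𝔵 : Arc κ) (X : KSch κ)

/-- The projection `π : ∇_𝔪 X ⟶ ∇_𝔫 X` for truncations `𝔪 ≥ 𝔫` of the arc. -/
def proj {n m : ℕ} (h : n ≤ m) : nabla X (𝔵.pt m) ⟶ nabla X (𝔵.pt n) :=
  nablaMap X (𝔵.incl h)

/-- The points of `∇_𝔵 X`, the projective limit of the `∇_𝔫 X`, with values in a fat point. -/
def limitPoints (U : (Fat κ)ᵒᵖ) : Set (∀ k : ℕ, (onFat (nabla X (𝔵.pt k))).obj U) :=
  {s | ∀ (k m : ℕ) (h : k ≤ m), (onFatMap (proj 𝔵 X h)).app U (s m) = s k}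

/-- `∇_{𝔵/𝔫} X`, the image of `∇_𝔵 X` in `∇_𝔫 X`. -/
def arcImage (n : ℕ) : KSieve κ where
  amb := nabla X (𝔵.pt n)
  sub :=
    { obj := fun U => (fun s => s n) '' limitPoints 𝔵 X U
      map := by
        rintro U V i _ ⟨s, hs, rfl⟩
        refine ⟨fun k => (onFat (nabla X (𝔵.pt k))).map i (s k), fun k m h => ?_, rfl⟩
        change (onFatMap (proj 𝔵 X h)).app V ((onFat (nabla X (𝔵.pt m))).map i (s m)) = _
        rw [NatTrans.naturality_apply, hs k m h] }

end ArcSpaces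

/-! ### Stability -/

section Stability

variable {κ : Type u} [Field κ]

/-- The map `𝒴 ⟶ 𝒳` of sieves induced by the map `π` of ambient spaces is a piecewise trivial
fibration with fiber the affine space of dimension `r`: there is a finite partition of `𝒳` into
formal sieves `S i` such that the part of `𝒴` above `S i` is isomorphic over `S i` to the product
of `S i` with the affine space. -/
def IsPiecewiseTrivial {𝒴 𝒳 : KSieve κ} (π : 𝒴.amb ⟶ 𝒳.amb) (r : ℕ) : Prop :=
  𝒴.sub ≤ 𝒳.sub.preimage (onFatMap π) ∧
  ∃ (k : ℕ) (S : Fin k → Subfunctor (onFat 𝒳.amb)),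
    (∀ i, KSieve.IsFormal ⟨𝒳.amb, S i⟩) ∧ (∀ i j, i ≠ j → S i ⊓ S j = ⊥) ∧
    (⨆ i, S i) = 𝒳.sub ∧
    ∀ i, ∃ e : KSieve.SieveIso ⟨𝒴.amb, 𝒴.sub ⊓ (S i).preimage (onFatMap π)⟩
        (KSieve.prod ⟨𝒳.amb, S i⟩ (KSieve.ofSch (affineSpace κ r))),
      e.iso.hom ≫ Subfunctor.ι _ ≫ onFatMap FunctorToTypes.prod.fst =
        Subfunctor.ι _ ≫ onFatMap π

variable (𝔵 : Arc κ) (X : KSch κ)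

/-- `∇_{𝔵/𝔪} X ⟶ ∇_{𝔵/𝔫} X` is a piecewise trivial fibration with fiber the affine space of
dimension `r`. -/
def IsArcFibration {n m : ℕ} (h : n ≤ m) (r : ℕ) : Prop :=
  IsPiecewiseTrivial (𝒴 := arcImage 𝔵 X m) (𝒳 := arcImage 𝔵 X n) (proj 𝔵 X h) r

/-- The dimension of a scheme of finite type over `κ` (`0` for the empty scheme). -/
def dimSch : ℕ := ((topologicalKrullDim X.left).unbotD 0).toNat

/-- `X` is `𝔵`-weakly stable from the truncation `𝔫₀` on: for `𝔪 ≥ 𝔫 ≥ 𝔫₀`, the images of the arcs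
are formal sieves and `∇_{𝔵/𝔪} X` is the union of the fibers of `∇_𝔪 X ⟶ ∇_𝔫 X` over
`∇_{𝔵/𝔫} X`. -/
def IsWeaklyStableFrom (n₀ : ℕ) : Prop :=
  (∀ n, n₀ ≤ n → (arcImage 𝔵 X n).IsFormal) ∧
  ∀ (n m : ℕ) (h : n ≤ m), n₀ ≤ n →
    (arcImage 𝔵 X m).sub = (arcImage 𝔵 X n).sub.preimage (onFatMap (proj 𝔵 X h))

/-- `X` is `𝔵`-laxly stable from the truncation `𝔫₀` on. -/
def IsLaxlyStableFrom (n₀ : ℕ) : Prop :=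
  IsWeaklyStableFrom 𝔵 X n₀ ∧
  ∀ (n m : ℕ) (h : n ≤ m), n₀ ≤ n → ∃ r : ℕ, IsArcFibration 𝔵 X h r

/-- `X` is `𝔵`-stable: it is `𝔵`-laxly stable, and for large `𝔫 ≤ 𝔪` the fiber of
`∇_{𝔵/𝔪} X ⟶ ∇_{𝔵/𝔫} X` is the affine space of dimension `dim X * (ℓ(𝔪) - ℓ(𝔫))`. -/
def IsStable : Prop :=
  ∃ n₀ : ℕ, 1 ≤ n₀ ∧ IsLaxlyStableFrom 𝔵 X n₀ ∧
    ∀ (n m : ℕ) (h : n ≤ m), n₀ ≤ n →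
      ∃ r : ℕ, (r : ℤ) = dimSch X * ((𝔵.len m : ℤ) - 𝔵.len n) ∧ IsArcFibration 𝔵 X h r

/-- `l` is the lax defect function of `X` relative to the truncation `𝔫₀`: for `𝔪 ≥ 𝔫₀` its value
is `r - dim X * (ℓ(𝔪) - ℓ(𝔫₀))`, where `∇_{𝔵/𝔪} X ⟶ ∇_{𝔵/𝔫₀} X` is a piecewise trivial fibration
with fiber the affine space of dimension `r`. -/
def IsLaxDefect (n₀ : ℕ) (l : ℕ → ℤ) : Prop :=
  ∀ (m : ℕ) (h : n₀ ≤ m), ∃ r : ℕ, IsArcFibration 𝔵 X h r ∧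
    l m = (r : ℤ) - dimSch X * ((𝔵.len m : ℤ) - 𝔵.len n₀)

/-- The motivic Poincaré series of `X` with respect to `𝔵`, the sum over the truncations `𝔫`,
`n ≥ 1`, of `[∇_{𝔵/𝔫} X] 𝕃 ^ (- dim X * ℓ(𝔫)) t ^ n`. -/
def poincareSeries : PowerSeries (HRing κ) :=
  PowerSeries.mk fun n =>
    if n = 0 then 0
    else algebraMap (GrForm κ) (HRing κ) (sieveClass (arcImage 𝔵 X n)) *
      ((lefschetzUnit κ ^ (-((dimSch X : ℤ) * 𝔵.len n)) : (HRing κ)ˣ) : HRing κ)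

end Stability

/-- The power series `1 / (1 - a t)`. -/
def geomSeries {A : Type*} [CommRing A] (a : A) : PowerSeries A :=
  PowerSeries.invOfUnit (1 - PowerSeries.C a * PowerSeries.X) 1

theorem geomSeries_mul {A : Type*} [CommRing A] (a : A) :
    geomSeries a * (1 - PowerSeries.C a * PowerSeries.X) = 1 :=
  PowerSeries.invOfUnit_mul _ 1 (by simp)

end

end SchemicMotivic

namespace SchemicMotivic

open Limits MonoidalCategory

noncomputable section

theorem isSch_hom_coprod_desc {X Y Z : Scheme.{u}} (f : X ⟶ Z) (g : Y ⟶ Z) [IsSeparated f]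
    [IsSeparated g] [LocallyOfFiniteType f] [LocallyOfFiniteType g] [QuasiCompact f]
    [QuasiCompact g] :
    IsSeparated (coprod.desc f g) ∧ LocallyOfFiniteType (coprod.desc f g) ∧
      QuasiCompact (coprod.desc f g) := by
  have h : coprod.desc f g = coprod.map f g ≫ coprod.desc (𝟙 Z) (𝟙 Z) := by simp
  have h1 := IsZariskiLocalAtTarget.coprodMap (P := @IsSeparated) f g inferInstance inferInstance
  have h2 : QuasiCompact (coprod.map f g) :=
    have : IsZariskiLocalAtTarget @QuasiCompact :=
      (HasAffineProperty.iff.mp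
        instHasAffinePropertyQuasiCompactCompactSpaceCarrierCarrierCommRingCat).1
    IsZariskiLocalAtTarget.coprodMap (P := @QuasiCompact) f g inferInstance inferInstance
  have h3 : LocallyOfFiniteType (coprod.map f g) :=
    have : IsZariskiLocalAtTarget @LocallyOfFiniteType :=
      HasRingHomProperty.instIsZariskiLocalAtTarget _
    IsZariskiLocalAtTarget.coprodMap (P := @LocallyOfFiniteType) f g inferInstance inferInstance
  rw [h]
  refine ⟨?_, ?_, ?_⟩ <;> infer_instance

variable {κ : Type u} [Field κ]

/-- The disjoint union of two `κ`-schemes. -/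
def disjUnion (X Y : KSch κ) : KSch κ := Over.mk (coprod.desc X.hom Y.hom)

/-- The first summand of a disjoint union. -/
def disjUnionInl (X Y : KSch κ) : X ⟶ disjUnion X Y :=
  Over.homMk coprod.inl (coprod.inl_desc X.hom Y.hom)

/-- The second summand of a disjoint union. -/
def disjUnionInr (X Y : KSch κ) : Y ⟶ disjUnion X Y :=
  Over.homMk coprod.inr (coprod.inr_desc X.hom Y.hom)

/-- The morphism on a disjoint union given by morphisms on the summands. -/
def disjUnionDesc {X Y Z : KSch κ} (f : X ⟶ Z) (g : Y ⟶ Z) : disjUnion X Y ⟶ Z :=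
  Over.homMk (coprod.desc f.left g.left) (by
    change coprod.desc f.left g.left ≫ Z.hom = coprod.desc X.hom Y.hom
    rw [coprod.desc_comp, Over.w f, Over.w g])

theorem disjUnionInl_desc {X Y Z : KSch κ} (f : X ⟶ Z) (g : Y ⟶ Z) :
    disjUnionInl X Y ≫ disjUnionDesc f g = f := by
  ext1
  exact coprod.inl_desc _ _

theorem disjUnionInr_desc {X Y Z : KSch κ} (f : X ⟶ Z) (g : Y ⟶ Z) :
    disjUnionInr X Y ≫ disjUnionDesc f g = g := by
  ext1
  exact coprod.inr_desc _ _

theorem IsSch.disjUnion {X Y : KSch κ} (hX : IsSch X) (hY : IsSch Y) :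
    IsSch (disjUnion X Y) := by
  obtain ⟨_, _, _⟩ := hX
  obtain ⟨_, _, _⟩ := hY
  exact isSch_hom_coprod_desc X.hom Y.hom

theorem IsSch.tensor {X Y : KSch κ} (hX : IsSch X) (hY : IsSch Y) : IsSch (X ⊗ Y) := by
  obtain ⟨_, _, _⟩ := hX
  obtain ⟨_, _, _⟩ := hY
  change IsSeparated (pullback.fst X.hom Y.hom ≫ X.hom) ∧
    LocallyOfFiniteType (pullback.fst X.hom Y.hom ≫ X.hom) ∧
    QuasiCompact (pullback.fst X.hom Y.hom ≫ X.hom)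
  refine ⟨?_, ?_, ?_⟩ <;> infer_instance

theorem isSch_tensorUnit : IsSch (𝟙_ (KSch κ)) := by
  change IsSeparated (𝟙 (Spec (CommRingCat.of κ))) ∧
    LocallyOfFiniteType (𝟙 (Spec (CommRingCat.of κ))) ∧
    QuasiCompact (𝟙 (Spec (CommRingCat.of κ)))
  refine ⟨?_, ?_, ?_⟩ <;> infer_instance

theorem isSch_affineSpace (r : ℕ) : IsSch (affineSpace κ r) := by
  dsimp only [affineSpace, IsSch, Over.mk_hom]
  refine ⟨?_, ?_, ?_⟩ <;> infer_instance

theorem isSch_of_isEmpty (X : KSch κ) [IsEmpty X.left] : IsSch X := by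
  refine ⟨?_, ?_, ?_⟩ <;> infer_instance

theorem Fat.nonempty_unique (𝔪 : Fat κ) : Nonempty (Unique 𝔪.obj.left) := by
  obtain ⟨-, i, -, hi⟩ := 𝔪.property
  have hsub : Subsingleton (𝟙_ (KSch κ)).left :=
    inferInstanceAs (Subsingleton (PrimeSpectrum κ))
  have hne : Nonempty (𝟙_ (KSch κ)).left := inferInstanceAs (Nonempty (PrimeSpectrum κ))
  have := hi.surj.subsingleton
  exact ⟨⟨⟨i.left hne.some⟩, fun a => Subsingleton.elim _ _⟩⟩

/-- A morphism from a fat point lifts to an open subscheme that contains its image. -/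
theorem Fat.exists_lift (𝔪 : Fat κ) {Z W : KSch κ} (f : 𝔪.obj ⟶ W) (j : Z ⟶ W)
    [IsOpenImmersion j.left] (x : 𝔪.obj.left) (hx : f.left x ∈ Set.range j.left) :
    ∃ g : 𝔪.obj ⟶ Z, g ≫ j = f := by
  obtain ⟨_⟩ := Fat.nonempty_unique 𝔪
  have hr : Set.range f.left ⊆ Set.range j.left := by
    rintro _ ⟨a, rfl⟩
    rwa [Subsingleton.elim a x]
  refine ⟨Over.homMk (IsOpenImmersion.lift j.left f.left hr) ?_, ?_⟩
  · rw [← Over.w j, IsOpenImmersion.lift_fac_assoc, Over.w f]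
  · ext1
    exact IsOpenImmersion.lift_fac _ _ _

/-- A morphism from a fat point to a disjoint union factors through one of the summands. -/
theorem Fat.factors_disjUnion (𝔪 : Fat κ) {X Y : KSch κ} (f : 𝔪.obj ⟶ disjUnion X Y) :
    (∃ g : 𝔪.obj ⟶ X, g ≫ disjUnionInl X Y = f) ∨
      ∃ g : 𝔪.obj ⟶ Y, g ≫ disjUnionInr X Y = f := by
  obtain ⟨_⟩ := Fat.nonempty_unique 𝔪
  have hc := (isCompl_range_inl_inr X.left Y.left).sup_eq_top
  have hx : f.left default ∈ Set.range (coprod.inl : X.left ⟶ X.left ⨿ Y.left) ⊔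
      Set.range (coprod.inr : Y.left ⟶ X.left ⨿ Y.left) := hc ▸ Set.mem_univ _
  have : IsOpenImmersion (disjUnionInl X Y).left :=
    inferInstanceAs (IsOpenImmersion (coprod.inl : X.left ⟶ X.left ⨿ Y.left))
  have : IsOpenImmersion (disjUnionInr X Y).left :=
    inferInstanceAs (IsOpenImmersion (coprod.inr : Y.left ⟶ X.left ⨿ Y.left))
  rcases hx with hx | hx
  · exact Or.inl (𝔪.exists_lift f (disjUnionInl X Y) default hx)
  · exact Or.inr (𝔪.exists_lift f (disjUnionInr X Y) default hx)

namespace KSieve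

/-- The product of two represented presheaves is represented by the product. -/
def representableByProd {P Q : (KSch κ)ᵒᵖ ⥤ Type u} {X Y : KSch κ} (hP : P.RepresentableBy X)
    (hQ : Q.RepresentableBy Y) : (FunctorToTypes.prod P Q).RepresentableBy (X ⊗ Y) where
  homEquiv := CartesianMonoidalCategory.homEquivToProd.trans (hP.homEquiv.prodCongr hQ.homEquiv)
  homEquiv_comp f g := by
    refine Prod.ext ?_ ?_
    · change hP.homEquiv ((f ≫ g) ≫ SemiCartesianMonoidalCategory.fst X Y) =
        P.map f.op (hP.homEquiv (g ≫ SemiCartesianMonoidalCategory.fst X Y))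
      rw [Category.assoc, hP.homEquiv_comp]
    · change hQ.homEquiv ((f ≫ g) ≫ SemiCartesianMonoidalCategory.snd X Y) =
        Q.map f.op (hQ.homEquiv (g ≫ SemiCartesianMonoidalCategory.snd X Y))
      rw [Category.assoc, hQ.homEquiv_comp]

theorem IsSieve.prod {𝒳 𝒴 : KSieve κ} (hX : 𝒳.IsSieve) (hY : 𝒴.IsSieve) :
    (𝒳.prod 𝒴).IsSieve := by
  obtain ⟨X, hX, ⟨eX⟩⟩ := hX
  obtain ⟨Y, hY, ⟨eY⟩⟩ := hY
  exact ⟨X ⊗ Y, hX.tensor hY, ⟨representableByProd eX eY⟩⟩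

theorem isFormal_ofSch {X : KSch κ} (hX : IsSch X) : (ofSch X).IsFormal := by
  refine ⟨⟨X, hX, ⟨Functor.RepresentableBy.yoneda X⟩⟩, fun 𝔪 => ⟨X, hX, 𝟙 _, le_top, ?_⟩⟩
  exact Set.eq_univ_of_forall fun x => ⟨x, rfl⟩

theorem isFormal_bot {P : (KSch κ)ᵒᵖ ⥤ Type u}
    (hP : ∃ W : KSch κ, IsSch W ∧ Nonempty (P.RepresentableBy W)) :
    IsFormal ⟨P, ⊥⟩ := by
  refine ⟨hP, fun 𝔪 => ?_⟩
  obtain ⟨W, -, ⟨e⟩⟩ := hP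
  let E : KSch κ := Over.mk (Scheme.emptyTo (Spec (CommRingCat.of κ)))
  have hE : IsEmpty E.left := inferInstanceAs (IsEmpty (∅ : Scheme))
  let φ : yoneda.obj E ⟶ P := yonedaEquiv.symm (e.homEquiv
    (Over.homMk (Scheme.emptyTo W.left) (Scheme.empty_ext _ _)))
  have hr : ∀ U, IsEmpty ((onFat (yoneda.obj E)).obj U) := fun U => by
    refine ⟨fun (f : U.unop.obj ⟶ E) => ?_⟩
    obtain ⟨_⟩ := Fat.nonempty_unique U.unop
    exact hE.elim (f.left default)
  refine ⟨E, isSch_of_isEmpty E, φ, ?_, ?_⟩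
  · rintro U _ ⟨x, rfl⟩
    exact ((hr U).false x).elim
  · exact Set.eq_empty_of_forall_notMem fun _ ⟨x, _⟩ => (hr _).false x

theorem IsFormal.sup {P : (KSch κ)ᵒᵖ ⥤ Type u} {A B : Subfunctor (onFat P)}
    (hA : IsFormal ⟨P, A⟩) (hB : IsFormal ⟨P, B⟩) : IsFormal ⟨P, A ⊔ B⟩ := by
  refine ⟨hA.1, fun 𝔪 => ?_⟩
  obtain ⟨Y, hY, φ, hφ, hφm⟩ := hA.2 𝔪
  obtain ⟨Z, hZ, ψ, hψ, hψm⟩ := hB.2 𝔪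
  obtain ⟨W, -, ⟨e⟩⟩ := hA.1
  let u := yoneda.preimage (φ ≫ e.toIso.inv)
  let v := yoneda.preimage (ψ ≫ e.toIso.inv)
  obtain ⟨χ, hl, hr⟩ : ∃ χ : yoneda.obj (disjUnion Y Z) ⟶ P,
      yoneda.map (disjUnionInl Y Z) ≫ χ = φ ∧ yoneda.map (disjUnionInr Y Z) ≫ χ = ψ := by
    refine ⟨yoneda.map (disjUnionDesc u v) ≫ e.toIso.hom, ?_, ?_⟩
    · rw [← Functor.map_comp_assoc, disjUnionInl_desc, Functor.map_preimage, Category.assoc,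
        Iso.inv_hom_id, Category.comp_id]
    · rw [← Functor.map_comp_assoc, disjUnionInr_desc, Functor.map_preimage, Category.assoc,
        Iso.inv_hom_id, Category.comp_id]
  have hrange : Subfunctor.range (onFatMap χ) =
      Subfunctor.range (onFatMap φ) ⊔ Subfunctor.range (onFatMap ψ) := by
    rw [← hl, ← hr]
    ext U x
    constructor
    · rintro ⟨f, rfl⟩
      rcases Fat.factors_disjUnion U.unop f with ⟨g, rfl⟩ | ⟨g, rfl⟩
      · exact Or.inl ⟨g, rfl⟩
      · exact Or.inr ⟨g, rfl⟩
    · rintro (⟨g, rfl⟩ | ⟨g, rfl⟩)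
      · exact ⟨g ≫ disjUnionInl Y Z, rfl⟩
      · exact ⟨g ≫ disjUnionInr Y Z, rfl⟩
  refine ⟨disjUnion Y Z, hY.disjUnion hZ, χ, ?_, ?_⟩
  · rw [hrange]
    exact sup_le_sup hφ hψ
  · rw [hrange]
    exact congrArg₂ (· ∪ ·) hφm hψm

theorem IsFormal.prod {𝒳 𝒴 : KSieve κ} (h𝒳 : 𝒳.IsFormal) (h𝒴 : 𝒴.IsFormal) :
    (𝒳.prod 𝒴).IsFormal := by
  refine ⟨h𝒳.1.prod h𝒴.1, fun 𝔪 => ?_⟩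
  obtain ⟨Y, hY, φ, hφ, hφm⟩ := h𝒳.2 𝔪
  obtain ⟨Z, hZ, ψ, hψ, hψm⟩ := h𝒴.2 𝔪
  refine ⟨Y ⊗ Z, hY.tensor hZ, FunctorToTypes.prod.lift
    (yoneda.map (SemiCartesianMonoidalCategory.fst Y Z) ≫ φ)
    (yoneda.map (SemiCartesianMonoidalCategory.snd Y Z) ≫ ψ), ?_, ?_⟩
  · rintro U _ ⟨f, rfl⟩
    exact ⟨hφ U ⟨f ≫ SemiCartesianMonoidalCategory.fst Y Z, rfl⟩,
      hψ U ⟨f ≫ SemiCartesianMonoidalCategory.snd Y Z, rfl⟩⟩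
  · apply Set.Subset.antisymm
    · rintro _ ⟨f, rfl⟩
      exact ⟨hφ _ ⟨f ≫ SemiCartesianMonoidalCategory.fst Y Z, rfl⟩,
        hψ _ ⟨f ≫ SemiCartesianMonoidalCategory.snd Y Z, rfl⟩⟩
    · rintro ⟨x, y⟩ ⟨hx, hy⟩
      change x ∈ 𝒳.sub.obj _ at hx
      change y ∈ 𝒴.sub.obj _ at hy
      rw [← hφm] at hx
      rw [← hψm] at hy
      obtain ⟨f, rfl⟩ := hx
      obtain ⟨g, rfl⟩ := hy
      refine ⟨CartesianMonoidalCategory.lift (C := KSch κ) f g, ?_⟩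
      refine Prod.ext ?_ ?_
      · exact congrArg (φ.app _) (CartesianMonoidalCategory.lift_fst (C := KSch κ) f g)
      · exact congrArg (ψ.app _) (CartesianMonoidalCategory.lift_snd (C := KSch κ) f g)

/-- Formality is invariant under isomorphism of sieves. -/
theorem IsFormal.of_sieveIso {𝒴 𝒳 : KSieve κ} (h𝒴 : 𝒴.IsSieve) (h𝒳 : 𝒳.IsFormal)
    (e : SieveIso 𝒴 𝒳) : 𝒴.IsFormal := by
  refine ⟨h𝒴, fun 𝔪 => ?_⟩
  obtain ⟨Z, hZ, φ, hφ, hφm⟩ := h𝒳.2 𝔪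
  obtain ⟨ψ, hψ⟩ := e.isSieveHom_inv Z hZ φ hφ
  have key : ∀ U (z : (onFat (yoneda.obj Z)).obj U), (onFatMap ψ).app U z =
      (e.iso.inv.app U ⟨(onFatMap φ).app U z, hφ U ⟨z, rfl⟩⟩).1 := fun U z => by
    rw [← hψ]
    rfl
  refine ⟨Z, hZ, ψ, ?_, ?_⟩
  · rintro U _ ⟨z, rfl⟩
    rw [key]
    exact Subtype.property _
  · apply Set.Subset.antisymm
    · rintro _ ⟨z, rfl⟩
      rw [key]
      exact Subtype.property _
    · intro y hy
      obtain ⟨z, hz⟩ := hφm.ge (e.iso.hom.app (op 𝔪) ⟨y, hy⟩).2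
      refine ⟨z, ?_⟩
      rw [key]
      have h1 : (⟨(onFatMap φ).app (op 𝔪) z, hφ _ ⟨z, rfl⟩⟩ : 𝒳.sub.toFunctor.obj (op 𝔪)) =
          e.iso.hom.app (op 𝔪) ⟨y, hy⟩ := Subtype.ext hz
      rw [h1]
      exact congrArg Subtype.val (e.iso.hom_inv_id_app_apply (op 𝔪) ⟨y, hy⟩)

/-- An isomorphism of ambient presheaves induces an isomorphism of sieves. -/
def sieveIsoOfIso {P Q : (KSch κ)ᵒᵖ ⥤ Type u} (α : P ≅ Q) (A : Subfunctor (onFat P))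
    (B : Subfunctor (onFat Q)) (h : A = B.preimage (onFatMap α.hom)) :
    SieveIso ⟨P, A⟩ ⟨Q, B⟩ where
  iso := {
    hom := Subfunctor.lift (A.ι ≫ onFatMap α.hom) (by
      rintro U _ ⟨x, rfl⟩
      exact h.le U x.2)
    inv := Subfunctor.lift (B.ι ≫ onFatMap α.inv) (by
      rintro U _ ⟨x, rfl⟩
      rw [h]
      change α.hom.app _ (α.inv.app _ x.1) ∈ B.obj U
      rw [α.inv_hom_id_app_apply]
      exact x.2)
    hom_inv_id := by
      ext U x
      apply Subtype.ext
      change α.inv.app (op U.unop.obj) (α.hom.app (op U.unop.obj) x.1) = x.1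
      exact α.hom_inv_id_app_apply _ _
    inv_hom_id := by
      ext U x
      apply Subtype.ext
      change α.hom.app (op U.unop.obj) (α.inv.app (op U.unop.obj) x.1) = x.1
      exact α.inv_hom_id_app_apply _ _ }
  isSieveHom_hom Z _ φ _ := ⟨φ ≫ α.hom, rfl⟩
  isSieveHom_inv Z _ φ _ := ⟨φ ≫ α.inv, rfl⟩

end KSieve

/-- The morphism of affine spaces selecting the coordinates given by `i`. -/
def affineSpaceReindex {r s : ℕ} (i : Fin s → Fin r) : affineSpace κ r ⟶ affineSpace κ s :=
  Over.homMk (AffineSpace.reindex (fun j => ULift.up (i j.down)) (Spec (CommRingCat.of κ)))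
    (AffineSpace.reindex_over _ _)

/-- The morphism to an affine space with given coordinates. -/
def toAffineSpace {T : KSch κ} {r : ℕ} (v : Fin r → Γ(T.left, ⊤)) : T ⟶ affineSpace κ r :=
  Over.homMk (AffineSpace.homOfVector T.hom (fun j => v j.down))
    (AffineSpace.homOfVector_over _ _)

/-- The coordinates of a morphism to an affine space. -/
def affineCoord {T : KSch κ} {r : ℕ} (f : T ⟶ affineSpace κ r) (j : Fin r) : Γ(T.left, ⊤) :=
  Scheme.Hom.appTop (Y := AffineSpace (ULift.{u} (Fin r)) (Spec (CommRingCat.of κ))) f.left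
    (AffineSpace.coord _ (ULift.up j))

theorem affineCoord_toAffineSpace {T : KSch κ} {r : ℕ} (v : Fin r → Γ(T.left, ⊤)) :
    affineCoord (toAffineSpace v) = v :=
  funext fun j => by
    change (AffineSpace.homOfVector T.hom fun j : ULift.{u} (Fin r) => v j.down).appTop
      (AffineSpace.coord _ (ULift.up j)) = v j
    rw [AffineSpace.homOfVector_appTop_coord]

theorem affineCoord_injective {T : KSch κ} {r : ℕ} :
    Function.Injective (affineCoord : (T ⟶ affineSpace κ r) → Fin r → Γ(T.left, ⊤)) := by
  intro f g h
  ext1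
  refine AffineSpace.hom_ext (S := Spec (CommRingCat.of κ)) (n := ULift.{u} (Fin r)) ?_ ?_
  · exact (Over.w f).trans (Over.w g).symm
  · rintro ⟨j⟩
    exact congrFun h j

theorem affineCoord_comp_reindex {T : KSch κ} {r s : ℕ} (f : T ⟶ affineSpace κ r)
    (i : Fin s → Fin r) : affineCoord (f ≫ affineSpaceReindex i) = affineCoord f ∘ i := by
  funext j
  have h : affineCoord (affineSpaceReindex (κ := κ) i) j = AffineSpace.coord _ (ULift.up (i j)) :=
    AffineSpace.reindex_appTop_coord (fun j : ULift.{u} (Fin s) => ULift.up.{u} (i j.down)) _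
      (ULift.up j)
  change Scheme.Hom.appTop (Y := AffineSpace (ULift.{u} (Fin r)) (Spec (CommRingCat.of κ))) f.left
    (affineCoord (affineSpaceReindex (κ := κ) i) j) = _
  rw [h]
  rfl

theorem affineSpace_succ_bijective (T : KSch κ) (r : ℕ) :
    Function.Bijective (fun f : T ⟶ affineSpace κ (r + 1) =>
      (f ≫ affineSpaceReindex Fin.castSucc, f ≫ affineSpaceReindex fun _ : Fin 1 => Fin.last r)) := by
  constructor
  · intro f g h
    have h1 := congrArg affineCoord (Prod.ext_iff.mp h).1
    have h2 := congrArg affineCoord (Prod.ext_iff.mp h).2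
    simp only [affineCoord_comp_reindex] at h1 h2
    refine affineCoord_injective (funext fun j => ?_)
    refine Fin.lastCases ?_ (fun j => ?_) j
    · exact congrFun h2 0
    · exact congrFun h1 j
  · rintro ⟨f, g⟩
    refine ⟨toAffineSpace (Fin.snoc (α := fun _ => Γ(T.left, ⊤)) (affineCoord f)
      (affineCoord g 0)), Prod.ext ?_ ?_⟩
    · apply affineCoord_injective
      funext j
      simp [affineCoord_comp_reindex, affineCoord_toAffineSpace]
    · apply affineCoord_injective
      funext j
      simp [affineCoord_comp_reindex, affineCoord_toAffineSpace, Subsingleton.elim j 0]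

/-- The functor of points of `𝔸 ^ (r + 1)` is the product of those of `𝔸 ^ r` and `𝔸 ^ 1`. -/
def affineSpaceSuccIso (r : ℕ) : yoneda.obj (affineSpace κ (r + 1)) ≅
    FunctorToTypes.prod (yoneda.obj (affineSpace κ r)) (yoneda.obj (affineSpace κ 1)) :=
  letI τ := FunctorToTypes.prod.lift
    (yoneda.map (affineSpaceReindex (κ := κ) (r := r + 1) Fin.castSucc))
    (yoneda.map (affineSpaceReindex fun _ : Fin 1 => Fin.last r))
  haveI : IsIso τ := by
    rw [NatTrans.isIso_iff_isIso_app]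
    intro T
    rw [isIso_iff_bijective]
    exact affineSpace_succ_bijective T.unop r
  asIso τ

/-- `𝔸 ^ 0` is the base. -/
def affineSpaceZeroIso : affineSpace κ 0 ≅ 𝟙_ (KSch κ) :=
  letI e : AffineSpace (ULift.{u} (Fin 0)) (Spec (CommRingCat.of κ)) ≅ Spec (CommRingCat.of κ) :=
    asIso (AffineSpace (ULift.{u} (Fin 0)) (Spec (CommRingCat.of κ)) ↘ Spec (CommRingCat.of κ))
  Over.isoMk e (Category.comp_id _)

open KSieve

theorem sieveClass_of_isFormal {𝒳 : KSieve κ} (h : 𝒳.IsFormal) :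
    sieveClass 𝒳 = Ideal.Quotient.mk _ (MvPolynomial.X ⟨𝒳, h⟩) :=
  dif_pos h

theorem mk_eq_zero_of_grRel {p : MvPolynomial (FormalSieve κ) ℤ} (h : GrRel κ p) :
    Ideal.Quotient.mk (Ideal.span {p | GrRel κ p}) p = 0 :=
  Ideal.Quotient.eq_zero_iff_mem.mpr (Ideal.subset_span h)

theorem sieveClass_eq_of_sieveIso {𝒴 𝒳 : KSieve κ} (h𝒴 : 𝒴.IsFormal) (h𝒳 : 𝒳.IsFormal)
    (e : SieveIso 𝒴 𝒳) : sieveClass 𝒴 = sieveClass 𝒳 := by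
  have h := mk_eq_zero_of_grRel (GrRel.iso ⟨𝒴, h𝒴⟩ ⟨𝒳, h𝒳⟩ e)
  rw [map_sub, sub_eq_zero] at h
  rw [sieveClass_of_isFormal h𝒴, sieveClass_of_isFormal h𝒳, h]

theorem sieveClass_bot {P : (KSch κ)ᵒᵖ ⥤ Type u} (h : IsFormal ⟨P, ⊥⟩) :
    sieveClass (⟨P, ⊥⟩ : KSieve κ) = 0 := by
  rw [sieveClass_of_isFormal h, mk_eq_zero_of_grRel (GrRel.empty P h)]

theorem sieveClass_prod {𝒳 𝒴 : KSieve κ} (h𝒳 : 𝒳.IsFormal) (h𝒴 : 𝒴.IsFormal) :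
    sieveClass (𝒳.prod 𝒴) = sieveClass 𝒳 * sieveClass 𝒴 := by
  have h := mk_eq_zero_of_grRel (GrRel.mul ⟨𝒳, h𝒳⟩ ⟨𝒴, h𝒴⟩ (h𝒳.prod h𝒴))
  rw [map_sub, sub_eq_zero, map_mul] at h
  rw [sieveClass_of_isFormal h𝒴, sieveClass_of_isFormal h𝒳, sieveClass_of_isFormal (h𝒳.prod h𝒴), h]

theorem sieveClass_tensorUnit : sieveClass (ofSch (𝟙_ (KSch κ))) = 1 := by
  have hf := isFormal_ofSch (κ := κ) isSch_tensorUnit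
  have h := mk_eq_zero_of_grRel (GrRel.one hf)
  rw [map_sub, sub_eq_zero, map_one] at h
  rw [sieveClass_of_isFormal hf, h]

theorem sieveClass_sup_of_disjoint {P : (KSch κ)ᵒᵖ ⥤ Type u} {A B : Subfunctor (onFat P)}
    (hA : IsFormal ⟨P, A⟩) (hB : IsFormal ⟨P, B⟩) (hd : A ⊓ B = ⊥) :
    sieveClass (⟨P, A ⊔ B⟩ : KSieve κ) = sieveClass ⟨P, A⟩ + sieveClass ⟨P, B⟩ := by
  have hbot := isFormal_bot hA.1
  have hi : IsFormal ⟨P, A ⊓ B⟩ := hd ▸ hbot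
  have h := mk_eq_zero_of_grRel (GrRel.scissor P A B hA hB (hA.sup hB) hi)
  rw [map_sub, map_sub, map_add, ← sieveClass_of_isFormal hA, ← sieveClass_of_isFormal hB,
    ← sieveClass_of_isFormal (hA.sup hB), ← sieveClass_of_isFormal hi, hd,
    sieveClass_bot hbot, sub_zero, sub_eq_zero] at h
  exact h.symm

theorem sieveClass_finset_sup {P : (KSch κ)ᵒᵖ ⥤ Type u} {ι : Type*} (S : ι → Subfunctor (onFat P))
    (hP : ∃ W : KSch κ, IsSch W ∧ Nonempty (P.RepresentableBy W))
    (hS : ∀ i, IsFormal ⟨P, S i⟩) (hd : ∀ i j, i ≠ j → S i ⊓ S j = ⊥) (s : Finset ι) :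
    IsFormal ⟨P, s.sup S⟩ ∧
      sieveClass (⟨P, s.sup S⟩ : KSieve κ) = ∑ i ∈ s, sieveClass ⟨P, S i⟩ := by
  classical
  induction s using Finset.induction_on with
  | empty => exact ⟨isFormal_bot hP, sieveClass_bot (isFormal_bot hP)⟩
  | insert a s ha ih =>
    have hdis : S a ⊓ s.sup S = ⊥ := by
      rw [Finset.sup_eq_iSup, inf_comm, Subfunctor.iSup_min]
      refine iSup_eq_bot.mpr fun i => ?_
      rw [Subfunctor.iSup_min]
      exact iSup_eq_bot.mpr fun hi => hd _ _ fun h => ha (h ▸ hi)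
    rw [Finset.sup_insert, Finset.sum_insert ha, ← ih.2]
    exact ⟨(hS a).sup ih.1, sieveClass_sup_of_disjoint (hS a) ih.1 hdis⟩

theorem sieveClass_iSup {P : (KSch κ)ᵒᵖ ⥤ Type u} {ι : Type*} [Fintype ι]
    (S : ι → Subfunctor (onFat P))
    (hP : ∃ W : KSch κ, IsSch W ∧ Nonempty (P.RepresentableBy W))
    (hS : ∀ i, IsFormal ⟨P, S i⟩) (hd : ∀ i j, i ≠ j → S i ⊓ S j = ⊥) :
    sieveClass (⟨P, ⨆ i, S i⟩ : KSieve κ) = ∑ i, sieveClass ⟨P, S i⟩ := by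
  rw [← Finset.sup_univ_eq_iSup]
  exact (sieveClass_finset_sup S hP hS hd Finset.univ).2

theorem sieveClass_affineSpace (r : ℕ) :
    sieveClass (ofSch (affineSpace κ r)) = lefschetz κ ^ r := by
  induction r with
  | zero =>
    rw [pow_zero, ← sieveClass_tensorUnit]
    exact sieveClass_eq_of_sieveIso (isFormal_ofSch (isSch_affineSpace 0))
      (isFormal_ofSch isSch_tensorUnit) (sieveIsoOfIso (yoneda.mapIso affineSpaceZeroIso) _ _ rfl)
  | succ r ih =>
    have hr := isFormal_ofSch (isSch_affineSpace (κ := κ) r)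
    have h1 := isFormal_ofSch (isSch_affineSpace (κ := κ) 1)
    rw [pow_succ, ← ih, lefschetz, ← sieveClass_prod hr h1]
    refine sieveClass_eq_of_sieveIso (isFormal_ofSch (isSch_affineSpace (r + 1)))
      (hr.prod h1) (sieveIsoOfIso (affineSpaceSuccIso r) _ _ ?_)
    ext U x
    exact ⟨fun _ => ⟨trivial, trivial⟩, fun _ => trivial⟩

/-- A piecewise trivial fibration with fiber `𝔸 ^ r` multiplies the class by `𝕃 ^ r`. -/
theorem IsPiecewiseTrivial.sieveClass_eq {𝒴 𝒳 : KSieve κ} (h𝒴 : 𝒴.IsSieve) (h𝒳 : 𝒳.IsSieve)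
    {π : 𝒴.amb ⟶ 𝒳.amb} {r : ℕ} (h : IsPiecewiseTrivial π r) :
    sieveClass 𝒴 = sieveClass 𝒳 * lefschetz κ ^ r := by
  obtain ⟨hle, k, S, hS, hd, hsup, he⟩ := h
  have hr := isFormal_ofSch (isSch_affineSpace (κ := κ) r)
  have hY : ∀ i, IsFormal ⟨𝒴.amb, 𝒴.sub ⊓ (S i).preimage (onFatMap π)⟩ := fun i =>
    IsFormal.of_sieveIso h𝒴 ((hS i).prod hr) (he i).choose
  have hYsup : ⨆ i, 𝒴.sub ⊓ (S i).preimage (onFatMap π) = 𝒴.sub := by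
    refine le_antisymm (iSup_le fun i => inf_le_left) fun U y hy => ?_
    have hx := hle U hy
    rw [← hsup, Subfunctor.preimage_obj, Subfunctor.iSup_obj] at hx
    obtain ⟨i, hi⟩ := Set.mem_iUnion.mp hx
    rw [Subfunctor.iSup_obj]
    exact Set.mem_iUnion.mpr ⟨i, hy, hi⟩
  have hYd : ∀ i j, i ≠ j → (𝒴.sub ⊓ (S i).preimage (onFatMap π)) ⊓
      (𝒴.sub ⊓ (S j).preimage (onFatMap π)) = ⊥ := fun i j hij => by
    refine le_bot_iff.mp fun U y hy => ?_
    exact (hd i j hij).le U ⟨hy.1.2, hy.2.2⟩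
  have e𝒴 := sieveClass_iSup _ h𝒴 hY hYd
  have e𝒳 := sieveClass_iSup _ h𝒳 hS hd
  rw [hYsup] at e𝒴
  rw [hsup] at e𝒳
  rw [show sieveClass 𝒴 = _ from e𝒴, show sieveClass 𝒳 = _ from e𝒳, Finset.sum_mul]
  refine Finset.sum_congr rfl fun i _ => ?_
  rw [sieveClass_eq_of_sieveIso (hY i) ((hS i).prod hr) (he i).choose,
    sieveClass_prod (hS i) hr, sieveClass_affineSpace]

end

/-- A power series with eventually geometric coefficients lies in the subalgebra generated by the
variable and the geometric series. -/
theorem mem_adjoin_of_coeff_eventually_geometric {A : Type*} [CommRing A] (a : Aˣ) (c : A) (n₀ : ℕ)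
    (f : PowerSeries A)
    (hf : ∀ n, n₀ ≤ n → PowerSeries.coeff n f = c * ((a ^ n : Aˣ) : A)) :
    f ∈ Algebra.adjoin A {PowerSeries.X, geomSeries (a : A)} := by
  set B := Algebra.adjoin A {PowerSeries.X, geomSeries (a : A)}
  have hX : (PowerSeries.X : PowerSeries A) ∈ B := Algebra.subset_adjoin (by simp)
  have hG : geomSeries (a : A) ∈ B := Algebra.subset_adjoin (by simp)
  have hC : ∀ x : A, PowerSeries.C x ∈ B := fun x => B.algebraMap_mem x
  have hpoly : ∀ p : Polynomial A, (p : PowerSeries A) ∈ B := fun p => by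
    induction p using Polynomial.induction_on' with
    | add p q hp hq => rw [Polynomial.coe_add]; exact B.add_mem hp hq
    | monomial n x =>
      rw [← Polynomial.C_mul_X_pow_eq_monomial, Polynomial.coe_mul, Polynomial.coe_C,
        Polynomial.coe_pow, Polynomial.coe_X]
      exact B.mul_mem (hC x) (B.pow_mem hX n)
  have hnum : f * ((1 : PowerSeries A) - PowerSeries.C (a : A) * PowerSeries.X) =
      (PowerSeries.trunc (n₀ + 1) (f * (1 - PowerSeries.C (a : A) * PowerSeries.X)) :
        PowerSeries A) := by
    ext n
    rw [Polynomial.coeff_coe, PowerSeries.coeff_trunc]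
    split_ifs with hn
    · rfl
    · obtain ⟨n, rfl⟩ : ∃ m, n = m + 1 := ⟨n - 1, by omega⟩
      rw [mul_sub, mul_one, map_sub, mul_left_comm, PowerSeries.coeff_C_mul,
        PowerSeries.coeff_succ_mul_X, hf _ (by omega), hf _ (by omega), pow_succ, Units.val_mul]
      ring
  have hfe : f = f * (1 - PowerSeries.C (a : A) * PowerSeries.X) * geomSeries (a : A) := by
    rw [mul_assoc, mul_comm (1 - _), geomSeries_mul, mul_one]
  rw [hfe, hnum]
  exact B.mul_mem (hpoly _) hG

section

variable {κ : Type u} [Field κ]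

theorem algebraMap_lefschetz_pow (r : ℕ) :
    algebraMap (GrForm κ) (HRing κ) (lefschetz κ ^ r) =
      ((lefschetzUnit κ ^ (r : ℤ) : (HRing κ)ˣ) : HRing κ) := by
  rw [zpow_natCast, Units.val_pow_eq_pow_val, map_pow]
  rfl

theorem poincareSeries_mem_adjoin (𝔵 : Arc κ) (X : KSch κ) (n₀ : ℕ) (l : ℕ → ℤ) (q b : ℤ)
    (hn₀ : 1 ≤ n₀) (hform : ∀ n, n₀ ≤ n → (arcImage 𝔵 X n).IsFormal) (hdef : IsLaxDefect 𝔵 X n₀ l)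
    (hl : ∀ n, n₀ ≤ n → l n = q * n + b) :
    poincareSeries 𝔵 X ∈ Algebra.adjoin (HRing κ)
      {PowerSeries.X, geomSeries ((lefschetzUnit κ ^ q : (HRing κ)ˣ) : HRing κ)} := by
  refine mem_adjoin_of_coeff_eventually_geometric (lefschetzUnit κ ^ q)
    (algebraMap (GrForm κ) (HRing κ) (sieveClass (arcImage 𝔵 X n₀)) *
      ((lefschetzUnit κ ^ (b - dimSch X * (𝔵.len n₀ : ℤ)) : (HRing κ)ˣ) : HRing κ)) n₀ _
    fun n hn => ?_
  obtain ⟨r, hr, hlr⟩ := hdef n hn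
  have hcl := IsPiecewiseTrivial.sieveClass_eq (hform n hn).1 (hform n₀ le_rfl).1 hr
  rw [poincareSeries, PowerSeries.coeff_mk, if_neg (by omega), hcl, map_mul,
    algebraMap_lefschetz_pow, mul_assoc, mul_assoc, ← Units.val_mul, ← Units.val_mul,
    ← zpow_add, ← zpow_natCast (lefschetzUnit κ ^ q), ← zpow_mul, ← zpow_add]
  congr 3
  rw [hl n hn] at hlr
  linarith

end

end SchemicMotivic

theorem mainTheorem12 {κ : Type u} [Field κ] (𝔵 : SchemicMotivic.Arc κ)
    (X : SchemicMotivic.KSch κ) (hX : SchemicMotivic.IsSch X) :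
    (∀ (n₀ : ℕ) (l : ℕ → ℤ) (q b : ℤ), 1 ≤ n₀ →
      SchemicMotivic.IsLaxlyStableFrom 𝔵 X n₀ →
      SchemicMotivic.IsLaxDefect 𝔵 X n₀ l →
      (∀ n, n₀ ≤ n → l n = q * n + b) →
      SchemicMotivic.poincareSeries 𝔵 X ∈
        Algebra.adjoin (SchemicMotivic.HRing κ)
          {PowerSeries.X, SchemicMotivic.geomSeries
            ((SchemicMotivic.lefschetzUnit κ ^ q : (SchemicMotivic.HRing κ)ˣ) :
              SchemicMotivic.HRing κ)}) ∧
    (SchemicMotivic.IsStable 𝔵 X →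
      SchemicMotivic.poincareSeries 𝔵 X ∈
        Algebra.adjoin (SchemicMotivic.HRing κ)
          {PowerSeries.X, SchemicMotivic.geomSeries (1 : SchemicMotivic.HRing κ)}) := by
  refine ⟨fun n₀ l q b hn₀ hst hdef hl =>
    SchemicMotivic.poincareSeries_mem_adjoin 𝔵 X n₀ l q b hn₀ hst.1.1 hdef hl, ?_⟩
  rintro ⟨n₀, hn₀, hst, hfib⟩
  have h := SchemicMotivic.poincareSeries_mem_adjoin 𝔵 X n₀ (fun _ => 0) 0 0 hn₀ hst.1.1
    (fun m hm => by
      obtain ⟨r, hr, hfr⟩ := hfib n₀ m hm le_rfl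
      exact ⟨r, hfr, by rw [hr, sub_self]⟩)
    (fun n _ => by simp)
  rwa [zpow_zero, Units.val_one] at h
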